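/- **Setting.** Let $L,T,K>0$, $1<\beta<2$, let $J,M,N\ge 1$ be integers, $h=L/M$, $\tau=T/N$, $x_i=ih$, $t_s=s\tau$. Put $m=2J$, $\Delta\alpha=\frac1{2J}$, $\alpha_r=r\,\Delta\alpha$ $(0\le r\le m)$. Let $\omega:[0,1]\to[0,\infty)$ satisfy $\omega(\alpha_r)>0$ for at least one $r<m$, and put $\lambda_r=d_r\,\omega(\alpha_r)\,\Delta\alpha$ with $d_0=d_m=\frac12$ and $d_r=1$ otherwise. Let $\sigma\in[\frac12,1]$ be the root of $$\sum_{r=0}^{m}\frac{\lambda_r}{\Gamma(3-\alpha_r)}\,\sigma^{1-\alpha_r}\Big[\sigma-\Big(1-\frac{\alpha_r}2\Big)\Big]\tau^{2-\alpha_r}=0 .$$ For $\alpha\in[0,1]$ let $$a_0^{(\alpha)}=\sigma^{1-\alpha},\qquad a_l^{(\alpha)}=(l+\sigma)^{1-\alpha}-(l-1+\sigma)^{1-\alpha}\quad(l\ge1),$$ $$b_l^{(\alpha)}=\frac{(l+\sigma)^{2-\alpha}-(l-1+\sigma)^{2-\alpha}}{2-\alpha}-\frac{(l+\sigma)^{1-\alpha}+(l-1+\sigma)^{1-\alpha}}2\quad(l\ge1).$$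 Let $c_0^{(1,\alpha)}=a_0^{(\alpha)}$ and, for $n\ge2$, $$c_0^{(n,\alpha)}=a_0^{(\alpha)}+b_1^{(\alpha)},\qquad c_k^{(n,\alpha)}=a_k^{(\alpha)}+b_{k+1}^{(\alpha)}-b_k^{(\alpha)}\ (1\le k\le n-2),\qquad c_{n-1}^{(n,\alpha)}=a_{n-1}^{(\alpha)}-b_{n-1}^{(\alpha)}.$$ Put $$\hat c_k^{(n)}=\sum_{r=0}^m\lambda_r\frac{\tau^{-\alpha_r}}{\Gamma(2-\alpha_r)}\,c_k^{(n,\alpha_r)},\qquad g_k^{(\beta)}=\frac{(-1)^k\,\Gamma(\beta+1)}{\Gamma(\frac\beta2-k+1)\,\Gamma(\frac\beta2+k+1)}\quad(k\in\mathbb Z),$$ $$c_*^{(\beta)}=\frac2\beta\,r_\beta,\qquad r_\beta=e^{-2}\,\frac{(4-\beta)(2-\beta)\beta}{(6+\beta)(4+\beta)(2+\beta)}\cdot\frac{\Gamma(\beta+1)}{\Gamma(\frac\beta2+1)^2}\Big(3+\frac\beta2\Big)^{\beta+1}.$$ For real functions $\phi$ and $f$ let $f_i^{n-1+\sigma}=f(x_i,t_{n-1+\sigma})$,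 and for grid functions $v$ let $\|v\|^2=h\sum_{i=1}^{M-1}v_i^2$. **Theorem (unconditional stability, one-dimensional case).** Let $\{u_i^n:\ 0\le i\le M,\ 0\le n\le N\}$ be real numbers that solve the difference scheme $$\sum_{k=0}^{n-1}\hat c_k^{(n)}\big(u_i^{n-k}-u_i^{n-k-1}\big)=-K h^{-\beta}\sum_{k=i-M}^{i}g_k^{(\beta)}\big[\sigma u_{i-k}^n+(1-\sigma)u_{i-k}^{n-1}\big]+f_i^{n-1+\sigma}\quad(1\le i\le M-1,\ 1\le n\le N),$$ $$u_0^n=u_M^n=0\quad(0\le n\le N),\qquad u_i^0=\phi(x_i)\quad(1\le i\le M-1).$$ Then, without any restriction on the step sizes $h,\tau,\Delta\alpha$, $$\|u^n\|^2\le\|u^0\|^2+\frac{(2L)^\beta}{K\,c_*^{(\beta)}\sum_{r=0}^m\frac{\lambda_r}{T^{\alpha_r}\,\Gamma(1-\alpha_r)}}\ \max_{1\le l\le n}\|f^{l-1+\sigma}\|^2,\qquad 1\le n\le N,$$ where the term $r=m$ (with $\alpha_m=1$) of the sum is $0$, because $1/\Gamma(0)=0$. -/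

import Mathlib

noncomputable section

namespace DistRiesz

/-- The node `α_r = r / (2J)` of the uniform grid on `[0, 1]`. -/
def node (J r : ℕ) : ℝ := (r : ℝ) / (2 * (J : ℝ))

/-- The weights `d_r` of the composite trapezoid formula: `1/2` at both ends, `1` inside. -/
def trapWeight (J r : ℕ) : ℝ := if r = 0 ∨ r = 2 * J then 1 / 2 else 1

/-- `λ_r = d_r ω(α_r) Δα`, with `Δα = 1 / (2J)`. -/
def lam (ω : ℝ → ℝ) (J r : ℕ) : ℝ := trapWeight J r * ω (node J r) * (1 / (2 * (J : ℝ)))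

/-- The function `F` whose positive root is the shift parameter `σ`. -/
def shiftFun (ω : ℝ → ℝ) (J : ℕ) (τ σ : ℝ) : ℝ :=
  ∑ r ∈ Finset.range (2 * J + 1),
    lam ω J r / Real.Gamma (3 - node J r) * σ ^ (1 - node J r) *
      (σ - (1 - node J r / 2)) * τ ^ (2 - node J r)

/-- `a_l^{(α)}`. -/
def coefA (σ α : ℝ) (l : ℕ) : ℝ :=
  if l = 0 then σ ^ (1 - α)
  else ((l : ℝ) + σ) ^ (1 - α) - ((l : ℝ) - 1 + σ) ^ (1 - α)

/-- `b_l^{(α)}`, used for `l ≥ 1` only. -/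
def coefB (σ α : ℝ) (l : ℕ) : ℝ :=
  1 / (2 - α) * (((l : ℝ) + σ) ^ (2 - α) - ((l : ℝ) - 1 + σ) ^ (2 - α)) -
    1 / 2 * (((l : ℝ) + σ) ^ (1 - α) + ((l : ℝ) - 1 + σ) ^ (1 - α))

/-- `c_k^{(n,α)}`, used for `0 ≤ k ≤ n - 1` only. -/
def coefC (σ α : ℝ) (n k : ℕ) : ℝ :=
  if n = 1 then coefA σ α 0
  else if k = 0 then coefA σ α 0 + coefB σ α 1
  else if k + 2 ≤ n then coefA σ α k + coefB σ α (k + 1) - coefB σ α k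
  else coefA σ α k - coefB σ α k

/-- `ĉ_k^{(n)}`, the coefficients of the interpolation approximation of
`∑ r, λ_r D_t^{α_r}` at the shifted time `t_{n-1+σ}`. -/
def coefHat (ω : ℝ → ℝ) (J : ℕ) (τ σ : ℝ) (n k : ℕ) : ℝ :=
  ∑ r ∈ Finset.range (2 * J + 1),
    lam ω J r * (τ ^ (-node J r) / Real.Gamma (2 - node J r)) * coefC σ (node J r) n k

/-- The fractional centred difference weights `g_k^{(β)}`. Since `Real.Gamma` vanishes at its poles
and `x / 0 = 0`, the convention `1 / Γ = 0` at the poles of `Γ` holds here. -/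
def gCoef (β : ℝ) (k : ℤ) : ℝ :=
  (-1 : ℝ) ^ k * Real.Gamma (β + 1) /
    (Real.Gamma (β / 2 - (k : ℝ) + 1) * Real.Gamma (β / 2 + (k : ℝ) + 1))

/-- `r_β`. -/
def rConst (β : ℝ) : ℝ :=
  Real.exp (-2) * ((4 - β) * (2 - β) * β / ((6 + β) * (4 + β) * (2 + β))) *
    (Real.Gamma (β + 1) / Real.Gamma (β / 2 + 1) ^ 2) * (3 + β / 2) ^ (β + 1)

/-- `c_*^{(β)} = (2 / β) r_β`. -/
def cStar (β : ℝ) : ℝ := 2 / β * rConst β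

/-- The discrete inner product `(v, w) = h ∑_{i=1}^{M-1} v_i w_i`. -/
def gridInner (h : ℝ) (M : ℕ) (v w : ℤ → ℝ) : ℝ :=
  h * ∑ i ∈ Finset.Icc (1 : ℤ) ((M : ℤ) - 1), v i * w i

/-- The discrete `L²` norm. -/
def gridNorm (h : ℝ) (M : ℕ) (v : ℤ → ℝ) : ℝ := Real.sqrt (gridInner h M v v)

/-- The samples `f_i^{n-1+σ} = f(x_i, t_{n-1+σ})`, with `x_i = i h` and
`t_{n-1+σ} = (n - 1 + σ) τ`. -/
def sourceGrid (f : ℝ → ℝ → ℝ) (h τ σ : ℝ) (n : ℕ) : ℤ → ℝ :=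
  fun i => f ((i : ℝ) * h) (((n : ℝ) - 1 + σ) * τ)

/-- `u n i = u_i^n` solves the difference scheme with `h = L / M`, `τ = T / N` and shift `σ`.
Only the values with `0 ≤ i ≤ M` and `0 ≤ n ≤ N` matter. -/
structure IsSchemeSolution (ω φ : ℝ → ℝ) (f : ℝ → ℝ → ℝ) (L T K β : ℝ) (J M N : ℕ) (σ : ℝ)
    (u : ℕ → ℤ → ℝ) : Prop where
  step : ∀ n : ℕ, 1 ≤ n → n ≤ N → ∀ i : ℤ, 1 ≤ i → i ≤ (M : ℤ) - 1 →
    ∑ k ∈ Finset.range n, coefHat ω J (T / N) σ n k * (u (n - k) i - u (n - k - 1) i) =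
      -K * (L / M) ^ (-β) *
          ∑ k ∈ Finset.Icc (i - (M : ℤ)) i,
            gCoef β k * (σ * u n (i - k) + (1 - σ) * u (n - 1) (i - k)) +
        sourceGrid f (L / M) (T / N) σ n i
  boundary_left : ∀ n : ℕ, n ≤ N → u n 0 = 0
  boundary_right : ∀ n : ℕ, n ≤ N → u n (M : ℤ) = 0
  initial : ∀ i : ℤ, 1 ≤ i → i ≤ (M : ℤ) - 1 → u 0 i = φ ((i : ℝ) * (L / M))

end DistRiesz

end

namespace DistRiesz

open Finset

/-! The proof is an energy estimate. Pair the scheme at level `n` with the shifted value `w = σ u^n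
+ (1-σ) u^{n-1}`, bound the time part below by half the same discrete derivative applied to the
squared norm, bound the space part below by coercivity, absorb the source with Young's inequality,
and close by a discrete Grönwall induction.

Time. Each `c_k` with `k ≥ 1` is, up to a nonnegative `b_{k+1}` missing from the last one, a second
difference of a single function `kernelH`, and for `n ≥ 2` `c_0` is a first difference. Concavity of
the derivative of `kernelH` makes the coefficients decrease from `k = 1` on. The first pair is
delicate, because the energy inequality `half_sum_sq_le_shift_mul_sum` needs `σ² ĉ_1 ≤ (2σ-1) ĉ_0`,
which is a statement about the sum over all orders. The root equation for `σ` says exactly that the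
weighted sum of `kernelH` at `σ` vanishes, so any multiple of that sum may be added for free; with
the factor `(σ+1)²` the inequality holds for every order separately (`kernelH_three_point`).

Space. The weights `g_k` are even, positive at `0` and nonpositive elsewhere, so the quadratic form
dominates its row sums. These telescope through `gTail`, which decays no faster than `k^{-β}`; this
yields the constant `c_*`.

The last coefficient `ĉ_{n-1}` is at least half the sum in the denominator of the bound, uniformly
in `n ≤ N`, and this closes the induction. -/

/-! ### Tangent-line bounds for real powers -/

theorem rpow_le_tangent {p x y : ℝ} (hp0 : 0 ≤ p) (hp1 : p ≤ 1) (hx : 0 < x) (hy : 0 ≤ y) :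
    y ^ p ≤ x ^ p + p * x ^ (p - 1) * (y - x) := by
  have h := rpow_one_add_le_one_add_mul_self (s := (y - x) / x)
    (by rw [le_div_iff₀ hx]; linarith) hp0 hp1
  have e : 1 + (y - x) / x = y / x := by field_simp; ring
  rw [e, Real.div_rpow hy hx.le, div_le_iff₀ (Real.rpow_pos_of_pos hx p)] at h
  rw [Real.rpow_sub_one hx.ne']
  calc y ^ p ≤ _ := h
    _ = _ := by field_simp

theorem tangent_le_rpow {p x y : ℝ} (hp : 1 ≤ p) (hx : 0 < x) (hy : 0 ≤ y) :
    x ^ p + p * x ^ (p - 1) * (y - x) ≤ y ^ p := by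
  have h := one_add_mul_self_le_rpow_one_add (s := (y - x) / x)
    (by rw [le_div_iff₀ hx]; linarith) hp
  have e : 1 + (y - x) / x = y / x := by field_simp; ring
  rw [e, Real.div_rpow hy hx.le, le_div_iff₀ (Real.rpow_pos_of_pos hx p)] at h
  rw [Real.rpow_sub_one hx.ne']
  calc _ = _ := by field_simp
    _ ≤ y ^ p := h

theorem tangent_le_rpow_neg {a x y : ℝ} (ha0 : 0 ≤ a) (ha1 : a ≤ 1) (hx : 0 < x) (hy : 0 < y) :
    x ^ (-a) - a * x ^ (-a - 1) * (y - x) ≤ y ^ (-a) := by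
  have h := rpow_le_tangent ha0 ha1 hx hy.le
  rw [Real.rpow_sub_one hx.ne'] at *
  rw [Real.rpow_neg hx.le, Real.rpow_neg hy.le]
  have hX := Real.rpow_pos_of_pos hx a
  have hY := Real.rpow_pos_of_pos hy a
  have hs : y ^ a ≤ x ^ a * (1 + a * ((y - x) / x)) := h.trans_eq (by field_simp)
  set s := a * ((y - x) / x) with hsdef
  have e : (x ^ a)⁻¹ - a * ((x ^ a)⁻¹ / x) * (y - x) = (1 - s) / x ^ a := by
    rw [hsdef]; field_simp
  have hpos : 0 < 1 + s := pos_of_mul_pos_right (hY.trans_le hs) hX.le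
  rw [e, ← one_div, div_le_div_iff₀ hX hY]
  rcases le_total (1 - s) 0 with h1 | h1
  · nlinarith
  · nlinarith [mul_le_mul_of_nonneg_left hs h1, mul_nonneg hX.le (sq_nonneg s)]

/-! ### The kernel behind the time coefficients -/

/-- An antiderivative of `x ^ (1 - a)`, corrected by the trapezoid term; its differences give the
coefficients `c_k^{(n,a)}`. -/
noncomputable def kernelH (a x : ℝ) : ℝ := x ^ (2 - a) / (2 - a) - x ^ (1 - a) / 2

theorem coefA_zero_add_coefB_one (s a : ℝ) :
    coefA s a 0 + coefB s a 1 = kernelH a (s + 1) - kernelH a s := by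
  simp only [coefA, coefB, kernelH, if_true]
  norm_num
  rw [add_comm 1 s]
  ring

theorem coefA_add_coefB_sub_coefB (s a : ℝ) {k : ℕ} (hk : 1 ≤ k) :
    coefA s a k + coefB s a (k + 1) - coefB s a k =
      kernelH a (k + s + 1) - 2 * kernelH a (k + s) + kernelH a (k + s - 1) := by
  have hk' : k ≠ 0 := by omega
  simp only [coefA, coefB, kernelH, if_neg hk']
  push_cast
  rw [show (k : ℝ) + 1 + s = k + s + 1 by ring, show (k : ℝ) + 1 - 1 + s = k + s by ring,
    show (k : ℝ) - 1 + s = k + s - 1 by ring]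
  ring

theorem hasDerivAt_kernelH {a x : ℝ} (ha : a ≤ 1) (hx : 0 < x) :
    HasDerivAt (kernelH a) (x ^ (1 - a) - (1 - a) * x ^ (-a) / 2) x := by
  have h2 : (2 - a) ≠ 0 := by linarith
  have h := ((Real.hasDerivAt_rpow_const (x := x) (p := 2 - a) (Or.inl hx.ne')).div_const
    (2 - a)).sub ((Real.hasDerivAt_rpow_const (x := x) (p := 1 - a) (Or.inl hx.ne')).div_const 2)
  refine h.congr_deriv ?_
  rw [show 2 - a - 1 = 1 - a by ring, show 1 - a - 1 = -a by ring]
  field_simp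

/-- The derivative of `kernelH` is `x^(1-a)`, concave, minus a nonnegative multiple of the convex
`x^(-a)`. It is therefore concave and its second differences are nonpositive. -/
theorem kernelH_second_difference_antitone {a x y : ℝ} (ha0 : 0 ≤ a) (ha1 : a ≤ 1) (hx : 0 < x)
    (hxy : x ≤ y) :
    kernelH a (y + 2) - 2 * kernelH a (y + 1) + kernelH a y ≤
      kernelH a (x + 2) - 2 * kernelH a (x + 1) + kernelH a x := by
  have hd : ∀ z ∈ Set.Ioi (0 : ℝ), HasDerivAt
      (fun z => kernelH a (z + 2) - 2 * kernelH a (z + 1) + kernelH a z)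
      (((z + 2) ^ (1 - a) - (1 - a) * (z + 2) ^ (-a) / 2) -
        2 * ((z + 1) ^ (1 - a) - (1 - a) * (z + 1) ^ (-a) / 2) +
        (z ^ (1 - a) - (1 - a) * z ^ (-a) / 2)) z := by
    intro z hz
    have hz : 0 < z := hz
    exact (((hasDerivAt_kernelH ha1 (by linarith : 0 < z + 2)).comp_add_const z 2).sub
      (((hasDerivAt_kernelH ha1 (by linarith : 0 < z + 1)).comp_add_const z 1).const_mul 2)).add
      (hasDerivAt_kernelH ha1 hz)
  refine antitoneOn_of_deriv_nonpos (convex_Ioi (0 : ℝ))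
    (fun z hz => (hd z hz).continuousAt.continuousWithinAt) ?_ ?_ hx (hx.trans_le hxy) hxy
  · rw [interior_Ioi]
    exact fun z hz => (hd z hz).differentiableAt.differentiableWithinAt
  · rw [interior_Ioi]
    intro z hz
    rw [(hd z hz).deriv]
    have hz : 0 < z := hz
    have hz1 : 0 < z + 1 := by linarith
    have c1 := rpow_le_tangent (p := 1 - a) (by linarith) (by linarith) hz1
      (by linarith : 0 ≤ z + 2)
    have c2 := rpow_le_tangent (p := 1 - a) (by linarith) (by linarith) hz1 hz.le
    have d1 := tangent_le_rpow_neg ha0 ha1 hz1 (by linarith : 0 < z + 2)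
    have d2 := tangent_le_rpow_neg ha0 ha1 hz1 hz
    have d : 0 ≤ (1 - a) * ((z + 2) ^ (-a) - 2 * (z + 1) ^ (-a) + z ^ (-a)) :=
      mul_nonneg (by linarith) (by nlinarith)
    nlinarith

/-- The trapezoid rule underestimates the integral of the concave function `x^(1-a)`. The proof lets
the right endpoint vary and differentiates the error. -/
theorem trapezoid_rpow_nonneg {a x : ℝ} (ha0 : 0 ≤ a) (ha1 : a ≤ 1) (hx : 0 < x) :
    0 ≤ 1 / (2 - a) * ((x + 1) ^ (2 - a) - x ^ (2 - a)) -
      1 / 2 * ((x + 1) ^ (1 - a) + x ^ (1 - a)) := by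
  have h2 : (2 - a) ≠ 0 := by linarith
  have hd : ∀ z ∈ Set.Ioi (0 : ℝ), HasDerivAt
      (fun z => 1 / (2 - a) * (z ^ (2 - a) - x ^ (2 - a)) -
        1 / 2 * ((z - x) * (z ^ (1 - a) + x ^ (1 - a))))
      ((z ^ (1 - a) - x ^ (1 - a) - (z - x) * ((1 - a) * z ^ (1 - a - 1))) / 2) z := by
    intro z hz
    have hz : z ≠ 0 := ne_of_gt hz
    have h := (((Real.hasDerivAt_rpow_const (x := z) (p := 2 - a) (Or.inl hz)).sub_const
      (x ^ (2 - a))).const_mul (1 / (2 - a))).sub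
      ((((hasDerivAt_id z).sub_const x).mul
        ((Real.hasDerivAt_rpow_const (x := z) (p := 1 - a) (Or.inl hz)).add_const
          (x ^ (1 - a)))).const_mul (1 / 2))
    refine h.congr_deriv ?_
    rw [show 2 - a - 1 = 1 - a by ring]
    simp only [id]
    field_simp
    ring
  have hmono := monotoneOn_of_deriv_nonneg (convex_Icc x (x + 1))
    (fun z hz => (hd z (hx.trans_le hz.1)).continuousAt.continuousWithinAt)
    (fun z hz => (hd z (hx.trans_le
      (interior_subset hz).1)).differentiableAt.differentiableWithinAt)
    (fun z hz => by
      have hz0 := hx.trans_le (interior_subset hz).1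
      rw [(hd z hz0).deriv]
      have := rpow_le_tangent (p := 1 - a) (by linarith) (by linarith) hz0 hx.le
      nlinarith)
    (Set.left_mem_Icc.mpr (by linarith)) (Set.right_mem_Icc.mpr (by linarith))
    (by linarith : x ≤ x + 1)
  simpa using hmono

theorem coefB_nonneg {s a : ℝ} (ha0 : 0 ≤ a) (ha1 : a ≤ 1) (hs : 0 < s) {l : ℕ} (hl : 1 ≤ l) :
    0 ≤ coefB s a l := by
  have hl' : (1 : ℝ) ≤ l := by exact_mod_cast hl
  have h := trapezoid_rpow_nonneg ha0 ha1 (by linarith : 0 < (l : ℝ) - 1 + s)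
  rw [show (l : ℝ) - 1 + s + 1 = l + s by ring] at h
  exact h

/-- The integral of `x^(1-a)` inside `coefB` is at most its value at the right endpoint. What is
left is half an increment of `x^(1-a)`, bounded below by the tangent at that endpoint. -/
theorem lower_bound_coefA_sub_coefB {s a : ℝ} (ha0 : 0 ≤ a) (ha1 : a ≤ 1) (hs : 0 < s) {l : ℕ}
    (hl : 1 ≤ l) : (1 - a) / 2 * ((l : ℝ) + s) ^ (-a) ≤ coefA s a l - coefB s a l := by
  have hl' : (1 : ℝ) ≤ l := by exact_mod_cast hl
  have hX : 0 < (l : ℝ) + s := by linarith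
  have hY : 0 ≤ (l : ℝ) - 1 + s := by linarith
  have h2 : 0 < 2 - a := by linarith
  have h1 := rpow_le_tangent (p := 1 - a) (by linarith) (by linarith) hX hY
  have h3 := tangent_le_rpow (p := 2 - a) (by linarith) hX hY
  rw [show 1 - a - 1 = -a by ring] at h1
  rw [show 2 - a - 1 = 1 - a by ring] at h3
  have h4 : 1 / (2 - a) * (((l : ℝ) + s) ^ (2 - a) - ((l : ℝ) - 1 + s) ^ (2 - a)) ≤
      ((l : ℝ) + s) ^ (1 - a) := by
    rw [one_div, inv_mul_le_iff₀ h2]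
    linarith
  simp only [coefA, coefB, if_neg (by omega : l ≠ 0)]
  linarith

/-! ### The inequality for the first two coefficients -/

/-- This is `kernelH_three_point` rescaled by `e = 1/(s+1)`, `y = 1-a`; equality holds at `y = 0`
and `y = 1`. Replacing both powers by their Bernoulli bounds leaves a slack of `y(1-y)e³(2-e)`. -/
theorem two_point_rpow_bound {e y : ℝ} (he0 : 1 / 2 ≤ e) (he1 : e ≤ 2 / 3) (hy0 : 0 ≤ y)
    (hy1 : y ≤ 1) :
    (1 - e) ^ 2 * (1 + e) ^ y * (2 + e - e * y) + (1 - e) ^ y * (2 - 3 * e - e * y) ≤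
      (2 - 2 * e - e ^ 2) * (2 - e - e * y) := by
  have hp : (1 + e) ^ y ≤ 1 + y * e :=
    rpow_one_add_le_one_add_mul_self (by linarith) hy0 hy1
  have hm : (1 - e) ^ y ≤ 1 - y * e := by
    have := rpow_one_add_le_one_add_mul_self (s := -e) (by linarith) hy0 hy1
    simpa [sub_eq_add_neg] using this
  -- Bernoulli for the reciprocal `(1-e)⁻¹` gives a lower bound, needed when the factor of `(1-e)^y`
  -- is negative.
  have hq : (1 - e) / (1 - (1 - y) * e) ≤ (1 - e) ^ y := by
    have h1 : 0 < 1 - e := by linarith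
    have h := rpow_one_add_le_one_add_mul_self (s := e / (1 - e))
      (by have : 0 ≤ e / (1 - e) := by positivity
          linarith) hy0 hy1
    have e1 : 1 + e / (1 - e) = (1 - e)⁻¹ := by field_simp; ring
    have h2 : 0 < 1 - (1 - y) * e := by nlinarith
    rw [e1, Real.inv_rpow h1.le] at h
    have hpos := Real.rpow_pos_of_pos h1 y
    rw [div_le_iff₀ h2]
    have h3 : 1 ≤ (1 - e) ^ y * (1 + y * (e / (1 - e))) := by
      have := mul_le_mul_of_nonneg_left h hpos.le
      rwa [mul_inv_cancel₀ hpos.ne'] at this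
    have h4 := mul_le_mul_of_nonneg_left h3 h1.le
    calc 1 - e = (1 - e) * 1 := by ring
      _ ≤ _ := h4
      _ = _ := by field_simp; ring
  have hey : 0 ≤ 2 + e - e * y := by nlinarith
  have s1 : (1 - e) ^ 2 * (1 + e) ^ y * (2 + e - e * y) ≤
      (1 - e) ^ 2 * (1 + y * e) * (2 + e - e * y) := by gcongr
  have hyy : 0 ≤ y * (1 - y) := mul_nonneg hy0 (by linarith)
  have key : (1 - e) ^ 2 * (1 + y * e) * (2 + e - e * y) + (1 - y * e) * (2 - 3 * e - e * y) +
      y * (1 - y) * e ^ 2 * (e * (2 - e)) = (2 - 2 * e - e ^ 2) * (2 - e - e * y) := by ring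
  have hpos : 0 ≤ y * (1 - y) * e ^ 2 * (e * (2 - e)) := by
    have : 0 ≤ e * (2 - e) := by nlinarith
    positivity
  rcases le_total 0 (2 - 3 * e - e * y) with h | h
  · have := mul_le_mul_of_nonneg_right hm h
    linarith
  · have h2 : 0 < 1 - (1 - y) * e := by nlinarith
    have s2 := mul_le_mul_of_nonpos_right hq h
    have e2 : (1 - e) / (1 - (1 - y) * e) =
        (1 - y * e) - y * (1 - y) * e ^ 2 / (1 - (1 - y) * e) := by
      rw [eq_sub_iff_add_eq, ← add_div, div_eq_iff h2.ne']
      ring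
    have s3 : y * (1 - y) * e ^ 2 / (1 - (1 - y) * e) * (-(2 - 3 * e - e * y)) ≤
        y * (1 - y) * e ^ 2 * (e * (2 - e)) := by
      -- The bound `a` below is affine in `y`; `a1` and `a0` are its cases `y = 1` and `y = 0`.
      have a1 : 4 * e - 2 ≤ e * (2 - e) := by nlinarith
      have a0 : 3 * e - 2 ≤ e * (2 - e) * (1 - e) := by
        have b1 : 0 ≤ 1 - e := by linarith
        have b2 : 0 ≤ 2 - e := by linarith
        have : 0 ≤ e * (2 - e) * (1 - e) := by positivity
        linarith
      have a : -(2 - 3 * e - e * y) ≤ e * (2 - e) * (1 - (1 - y) * e) := by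
        nlinarith [mul_le_mul_of_nonneg_left a1 hy0,
          mul_le_mul_of_nonneg_left a0 (by linarith : 0 ≤ 1 - y)]
      have b := mul_le_mul_of_nonneg_left a
        (by positivity : 0 ≤ y * (1 - y) * e ^ 2)
      rw [div_mul_eq_mul_div, div_le_iff₀ h2]
      exact b.trans_eq (by ring)
    rw [e2] at s2
    nlinarith

theorem kernelH_eq {a x : ℝ} (ha : a ≤ 1) (hx : 0 < x) :
    kernelH a x = x ^ (1 - a) * (2 * x - 2 + a) / (2 * (2 - a)) := by
  have : 2 - a ≠ 0 := by linarith
  rw [kernelH, show 2 - a = 1 - a + 1 by ring, Real.rpow_add_one hx.ne']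
  have : 1 - a + 1 ≠ 0 := by linarith
  field_simp
  ring

/-- The factor `(s+1)²` is chosen to give equality at both `a = 0` and `a = 1`. Its term disappears
after averaging over the orders at the root `σ`. -/
theorem kernelH_three_point {a s : ℝ} (ha0 : 0 ≤ a) (ha1 : a ≤ 1) (hs0 : 1 / 2 ≤ s)
    (hs1 : s ≤ 1) :
    s ^ 2 * kernelH a (s + 2) + (s + 1) ^ 2 * kernelH a s ≤
      (2 * s ^ 2 + 2 * s - 1) * kernelH a (s + 1) := by
  have hp : 0 < s + 1 := by linarith
  have h := two_point_rpow_bound (e := 1 / (s + 1)) (y := 1 - a)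
    (by rw [le_div_iff₀ hp]; linarith) (by rw [div_le_iff₀ hp]; linarith)
    (by linarith) (by linarith)
  rw [show 1 + 1 / (s + 1) = (s + 2) / (s + 1) by field_simp; ring,
    show 1 - 1 / (s + 1) = s / (s + 1) by field_simp; ring,
    Real.div_rpow (by linarith) hp.le, Real.div_rpow (by linarith) hp.le] at h
  rw [kernelH_eq ha1 (by linarith), kernelH_eq ha1 (by linarith), kernelH_eq ha1 (by linarith)]
  have hP := Real.rpow_pos_of_pos hp (1 - a)
  have h2 : 0 < 2 - a := by linarith
  set P := (s + 1) ^ (1 - a)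
  set Q := (s + 2) ^ (1 - a)
  set R := s ^ (1 - a)
  have h3 := mul_le_mul_of_nonneg_left h (by positivity : 0 ≤ (s + 1) ^ 3 * P / (2 * (2 - a)))
  refine le_of_eq_of_le ?_ (h3.trans_eq ?_)
  · field_simp
    ring
  · field_simp
    ring

/-! ### Coefficients of a single order -/

theorem coefC_zero {s a : ℝ} {n : ℕ} (hn : 2 ≤ n) :
    coefC s a n 0 = kernelH a (s + 1) - kernelH a s := by
  rw [coefC, if_neg (by omega), if_pos rfl, coefA_zero_add_coefB_one]

theorem coefC_le_second_difference {s a : ℝ} (ha0 : 0 ≤ a) (ha1 : a ≤ 1) (hs : 0 < s) {n k : ℕ}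
    (hk : 1 ≤ k) (hkn : k + 1 ≤ n) :
    coefC s a n k ≤
      kernelH a (k + s + 1) - 2 * kernelH a (k + s) + kernelH a (k + s - 1) := by
  rw [← coefA_add_coefB_sub_coefB s a hk, coefC, if_neg (by omega), if_neg (by omega)]
  have := coefB_nonneg ha0 ha1 hs (by omega : 1 ≤ k + 1)
  split_ifs <;> linarith

theorem coefC_succ_le {s a : ℝ} (ha0 : 0 ≤ a) (ha1 : a ≤ 1) (hs : 0 < s) {n k : ℕ}
    (hk : 1 ≤ k) (hkn : k + 2 ≤ n) : coefC s a n (k + 1) ≤ coefC s a n k := by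
  have hk1 : (1 : ℝ) ≤ k := by exact_mod_cast hk
  refine (coefC_le_second_difference ha0 ha1 hs (by omega) (by omega)).trans ?_
  rw [coefC, if_neg (by omega), if_neg (by omega), if_pos hkn, coefA_add_coefB_sub_coefB s a hk]
  have h := kernelH_second_difference_antitone (y := k + s) ha0 ha1
    (by linarith : 0 < (k : ℝ) + s - 1) (by linarith)
  push_cast
  rw [show (k : ℝ) + s - 1 + 2 = k + s + 1 by ring, show (k : ℝ) + s - 1 + 1 = k + s by ring] at h
  rw [show (k : ℝ) + 1 + s + 1 = k + s + 2 by ring, show (k : ℝ) + 1 + s = k + s + 1 by ring,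
    show (k : ℝ) + s + 1 - 1 = k + s by ring]
  exact h

theorem le_coefC_last {s a : ℝ} (ha0 : 0 ≤ a) (ha1 : a ≤ 1) (hs : 1 / 2 ≤ s) {n : ℕ}
    (hn : 1 ≤ n) : (1 - a) / 2 * ((n : ℝ) - 1 + s) ^ (-a) ≤ coefC s a n (n - 1) := by
  have hs0 : 0 < s := by linarith
  obtain ⟨l, rfl⟩ : ∃ l, n = l + 1 := ⟨n - 1, by omega⟩
  rw [Nat.add_sub_cancel]
  push_cast
  rw [add_sub_cancel_right]
  rcases Nat.eq_zero_or_pos l with rfl | hl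
  · rw [coefC, if_pos rfl, coefA, if_pos rfl, show 1 - a = -a + 1 by ring,
      Real.rpow_add_one hs0.ne']
    have := Real.rpow_pos_of_pos hs0 (-a)
    simp only [Nat.cast_zero, zero_add]
    nlinarith
  · rw [coefC, if_neg (by omega), if_neg (by omega), if_neg (by omega)]
    exact lower_bound_coefA_sub_coefB ha0 ha1 hs0 hl

/-! ### Coefficients summed over the orders -/

theorem node_nonneg (J r : ℕ) : 0 ≤ node J r := by unfold node; positivity

theorem node_le_one {J r : ℕ} (hr : r ∈ range (2 * J + 1)) : node J r ≤ 1 := by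
  have h : r ≤ 2 * J := by simpa [Nat.lt_succ_iff] using hr
  exact div_le_one_of_le₀ (by exact_mod_cast h) (by positivity)

theorem lam_nonneg {ω : ℝ → ℝ} (hω : ∀ α ∈ Set.Icc (0 : ℝ) 1, 0 ≤ ω α) {J r : ℕ}
    (hr : r ∈ range (2 * J + 1)) : 0 ≤ lam ω J r := by
  have h1 : 0 ≤ ω (node J r) := hω _ ⟨node_nonneg J r, node_le_one hr⟩
  have h2 : 0 ≤ trapWeight J r := by unfold trapWeight; split_ifs <;> norm_num
  unfold lam
  positivity

theorem hat_weight_nonneg {ω : ℝ → ℝ} (hω : ∀ α ∈ Set.Icc (0 : ℝ) 1, 0 ≤ ω α) {J r : ℕ}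
    (hr : r ∈ range (2 * J + 1)) {τ : ℝ} (hτ : 0 < τ) :
    0 ≤ lam ω J r * (τ ^ (-node J r) / Real.Gamma (2 - node J r)) :=
  mul_nonneg (lam_nonneg hω hr) (div_nonneg (Real.rpow_nonneg hτ.le _)
    (Real.Gamma_nonneg_of_nonneg (by linarith [node_le_one hr])))

theorem coefHat_succ_le {ω : ℝ → ℝ} (hω : ∀ α ∈ Set.Icc (0 : ℝ) 1, 0 ≤ ω α) (J : ℕ) {τ s : ℝ}
    (hτ : 0 < τ) (hs : 0 < s) {n k : ℕ} (hk : 1 ≤ k) (hkn : k + 2 ≤ n) :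
    coefHat ω J τ s n (k + 1) ≤ coefHat ω J τ s n k :=
  sum_le_sum fun _ hr => mul_le_mul_of_nonneg_left
    (coefC_succ_le (node_nonneg _ _) (node_le_one hr) hs hk hkn) (hat_weight_nonneg hω hr hτ)

/-- Since `Γ(3-α) = (2-α)Γ(2-α)`, `shiftFun` is `τ²` times this sum. -/
theorem sum_weight_kernelH_eq_zero {ω : ℝ → ℝ} {J : ℕ} {τ s : ℝ} (hτ : 0 < τ) (hs : 0 < s)
    (h : shiftFun ω J τ s = 0) :
    ∑ r ∈ range (2 * J + 1), lam ω J r * (τ ^ (-node J r) / Real.Gamma (2 - node J r)) *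
      kernelH (node J r) s = 0 := by
  have h2 : τ ^ 2 * ∑ r ∈ range (2 * J + 1),
      lam ω J r * (τ ^ (-node J r) / Real.Gamma (2 - node J r)) * kernelH (node J r) s = 0 := by
    rw [← h, shiftFun, mul_sum]
    refine sum_congr rfl fun r hr => ?_
    have ha1 := node_le_one hr
    have h2 : 2 - node J r ≠ 0 := by linarith
    have hG : Real.Gamma (2 - node J r) ≠ 0 := (Real.Gamma_pos_of_pos (by linarith)).ne'
    rw [kernelH_eq ha1 hs, show 3 - node J r = 2 - node J r + 1 by ring, Real.Gamma_add_one h2,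
      show τ ^ (2 - node J r) = τ ^ 2 * τ ^ (-node J r) by
        rw [sub_eq_add_neg, Real.rpow_add hτ, Real.rpow_two]]
    field_simp
    ring
  exact (mul_eq_zero.mp h2).resolve_left (by positivity)

theorem sq_mul_coefHat_one_le {ω : ℝ → ℝ} (hω : ∀ α ∈ Set.Icc (0 : ℝ) 1, 0 ≤ ω α) (J : ℕ)
    {τ s : ℝ} (hτ : 0 < τ) (hs0 : 1 / 2 ≤ s) (hs1 : s ≤ 1) (h : shiftFun ω J τ s = 0) {n : ℕ}
    (hn : 2 ≤ n) : s ^ 2 * coefHat ω J τ s n 1 ≤ (2 * s - 1) * coefHat ω J τ s n 0 := by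
  have hs : 0 < s := by linarith
  have h0 := sum_weight_kernelH_eq_zero hτ hs h
  set W : ℕ → ℝ := fun r => lam ω J r * (τ ^ (-node J r) / Real.Gamma (2 - node J r)) with hW
  have e0 : coefHat ω J τ s n 0 = ∑ r ∈ range (2 * J + 1), W r * kernelH (node J r) (s + 1) -
      ∑ r ∈ range (2 * J + 1), W r * kernelH (node J r) s := by
    rw [coefHat, ← sum_sub_distrib]
    exact sum_congr rfl fun r _ => by rw [coefC_zero hn, mul_sub]
  have e1 : coefHat ω J τ s n 1 ≤ ∑ r ∈ range (2 * J + 1), W r * kernelH (node J r) (s + 2) -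
      2 * ∑ r ∈ range (2 * J + 1), W r * kernelH (node J r) (s + 1) +
      ∑ r ∈ range (2 * J + 1), W r * kernelH (node J r) s := by
    rw [coefHat, mul_sum, ← sum_sub_distrib, ← sum_add_distrib]
    refine sum_le_sum fun r hr => ?_
    have h := mul_le_mul_of_nonneg_left (coefC_le_second_difference (node_nonneg J r)
      (node_le_one hr) hs le_rfl hn) (hat_weight_nonneg hω hr hτ)
    rw [Nat.cast_one, show (1 : ℝ) + s + 1 = s + 2 by ring, add_comm 1 s, add_sub_cancel_right] at h
    exact h.trans_eq (by rw [hW]; ring)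
  have e2 : s ^ 2 * ∑ r ∈ range (2 * J + 1), W r * kernelH (node J r) (s + 2) +
      (s + 1) ^ 2 * ∑ r ∈ range (2 * J + 1), W r * kernelH (node J r) s ≤
      (2 * s ^ 2 + 2 * s - 1) * ∑ r ∈ range (2 * J + 1), W r * kernelH (node J r) (s + 1) := by
    simp only [mul_sum]
    rw [← sum_add_distrib]
    refine sum_le_sum fun r hr => ?_
    have h := mul_le_mul_of_nonneg_left (kernelH_three_point (node_nonneg J r)
      (node_le_one hr) hs0 hs1) (hat_weight_nonneg hω hr hτ)
    linarith
  rw [h0] at e0 e1 e2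
  have := mul_le_mul_of_nonneg_left e1 (sq_nonneg s)
  rw [e0]
  linarith

theorem coefHat_antitone {ω : ℝ → ℝ} (hω : ∀ α ∈ Set.Icc (0 : ℝ) 1, 0 ≤ ω α) (J : ℕ)
    {τ s : ℝ} (hτ : 0 < τ) (hs0 : 1 / 2 ≤ s) (hs1 : s ≤ 1) (h : shiftFun ω J τ s = 0) {n : ℕ}
    (hpos : 0 < coefHat ω J τ s n (n - 1)) {k : ℕ} (hk : k + 2 ≤ n) :
    coefHat ω J τ s n (k + 1) ≤ coefHat ω J τ s n k := by
  rcases Nat.eq_zero_or_pos k with rfl | hk0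
  · have hs : 0 < s := by linarith
    have hlast : ∀ j, 1 ≤ j → j + 1 ≤ n → coefHat ω J τ s n j ≤ coefHat ω J τ s n 1 := by
      intro j hj
      induction j, hj using Nat.le_induction with
      | base => exact fun _ => le_rfl
      | succ j hj ih => exact fun hjn =>
          (coefHat_succ_le hω J hτ hs hj (by omega)).trans (ih (by omega))
    have h1 : 0 < coefHat ω J τ s n 1 := hpos.trans_le (hlast (n - 1) (by omega) (by omega))
    have h2 := sq_mul_coefHat_one_le hω J hτ hs0 hs1 h hk
    -- At `s = 1/2` the inequality `h2` would force the positive `ĉ_1` to be nonpositive.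
    have h3 : 0 < 2 * s - 1 := by
      rcases hs0.eq_or_lt with rfl | hlt
      · norm_num at h2
        linarith
      · linarith
    -- Here `2s-1 ≤ s²`, the difference being `(1-s)²`.
    have h4 : 0 ≤ (2 * s - 1) * (coefHat ω J τ s n 0 - coefHat ω J τ s n 1) := by
      have := mul_nonneg (sq_nonneg (1 - s)) h1.le
      linarith
    exact sub_nonneg.mp (nonneg_of_mul_nonneg_right h4 h3)
  · exact coefHat_succ_le hω J hτ (by linarith) hk0 hk

/-- The lower bound for the last coefficient becomes `t_{n-1+σ}^(-α) / (2Γ(1-α))`, and `t_{n-1+σ} ≤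
T`. -/
theorem half_sum_le_coefHat_last {ω : ℝ → ℝ} (hω : ∀ α ∈ Set.Icc (0 : ℝ) 1, 0 ≤ ω α) (J : ℕ)
    {T s : ℝ} (hT : 0 < T) (hs0 : 1 / 2 ≤ s) (hs1 : s ≤ 1) {n N : ℕ} (hn : 1 ≤ n) (hnN : n ≤ N) :
    (∑ r ∈ range (2 * J + 1), lam ω J r / (T ^ node J r * Real.Gamma (1 - node J r))) / 2 ≤
      coefHat ω J (T / N) s n (n - 1) := by
  have hN : (0 : ℝ) < N := by exact_mod_cast (by omega : 0 < N)
  have hτ : 0 < T / N := by positivity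
  have hn1 : (1 : ℝ) ≤ n := by exact_mod_cast hn
  have hnN' : (n : ℝ) ≤ N := by exact_mod_cast hnN
  have ht0 : 0 < (n : ℝ) - 1 + s := by linarith
  have ht : T / N * ((n : ℝ) - 1 + s) ≤ T := by
    rw [div_mul_eq_mul_div, div_le_iff₀ hN]
    gcongr
    linarith
  rw [sum_div, coefHat]
  refine sum_le_sum fun r hr => ?_
  have ha0 := node_nonneg J r
  have ha1 := node_le_one hr
  refine le_trans ?_ (mul_le_mul_of_nonneg_left (le_coefC_last ha0 ha1 hs0 hn)
    (hat_weight_nonneg hω hr hτ))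
  rcases ha1.eq_or_lt with ha | ha
  -- At order `1` both sides vanish: `Real.Gamma 0 = 0` and division by zero gives `0`.
  · simp [ha]
  · have h1 : 0 < 1 - node J r := by linarith
    have hG := Real.Gamma_pos_of_pos h1
    have e : lam ω J r * ((T / N) ^ (-node J r) / Real.Gamma (2 - node J r)) *
        ((1 - node J r) / 2 * ((n : ℝ) - 1 + s) ^ (-node J r)) =
        lam ω J r / Real.Gamma (1 - node J r) / 2 *
          (T / N * ((n : ℝ) - 1 + s)) ^ (-node J r) := by
      rw [show 2 - node J r = 1 - node J r + 1 by ring, Real.Gamma_add_one h1.ne',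
        Real.mul_rpow hτ.le ht0.le]
      field_simp
    have e2 : lam ω J r / (T ^ node J r * Real.Gamma (1 - node J r)) / 2 =
        lam ω J r / Real.Gamma (1 - node J r) / 2 * T ^ (-node J r) := by
      rw [Real.rpow_neg hT.le]
      field_simp
    rw [e, e2]
    exact mul_le_mul_of_nonneg_left
      (Real.rpow_le_rpow_of_nonpos (by positivity) ht (by linarith))
      (div_nonneg (div_nonneg (lam_nonneg hω hr) hG.le) two_pos.le)

theorem sum_lam_div_pos {ω : ℝ → ℝ} (hω : ∀ α ∈ Set.Icc (0 : ℝ) 1, 0 ≤ ω α) {J : ℕ} (hJ : 1 ≤ J)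
    {T : ℝ} (hT : 0 < T) (hωpos : ∃ r : ℕ, r < 2 * J ∧ 0 < ω (node J r)) :
    0 < ∑ r ∈ range (2 * J + 1), lam ω J r / (T ^ node J r * Real.Gamma (1 - node J r)) := by
  obtain ⟨r, hr, hpos⟩ := hωpos
  refine sum_pos' (fun r hr => div_nonneg (lam_nonneg hω hr) (mul_nonneg (Real.rpow_nonneg hT.le _)
    (Real.Gamma_nonneg_of_nonneg (by linarith [node_le_one hr])))) ⟨r, by simp; omega, ?_⟩
  have hJ' : (0 : ℝ) < J := by exact_mod_cast hJ
  have h1 : node J r < 1 := by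
    rw [node, div_lt_one (by positivity)]
    exact_mod_cast hr
  have hG := Real.Gamma_pos_of_pos (by linarith : 0 < 1 - node J r)
  have hw : 0 < trapWeight J r := by unfold trapWeight; split_ifs <;> norm_num
  have hTp := Real.rpow_pos_of_pos hT (node J r)
  unfold lam
  positivity

/-! ### Summation by parts and the shifted energy inequality -/

/-- Summation by parts for antitone coefficients and nonnegative values. -/
theorem sub_le_sum_mul_sub {c y : ℕ → ℝ} (m : ℕ) (hc : ∀ k < m, c (k + 1) ≤ c k)
    (hy : ∀ k, 1 ≤ k → k ≤ m → 0 ≤ y k) :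
    c m * y (m + 1) - c 0 * y 0 ≤ ∑ k ∈ range (m + 1), c k * (y (k + 1) - y k) := by
  induction m with
  | zero => simp; linarith
  | succ m ih =>
    rw [sum_range_succ]
    have h := ih (fun k hk => hc k (by omega)) (fun k h1 h2 => hy k h1 (by omega))
    have := mul_le_mul_of_nonneg_right (hc m (by omega)) (hy (m + 1) (by omega) le_rfl)
    linarith

/-- The discrete analogue of `v v' ≥ (v²)' / 2` for the shifted value `s v^n + (1 - s) v^{n-1}`. -/
theorem half_sum_sq_le_shift_mul_sum {c v : ℕ → ℝ} {n : ℕ} {s : ℝ} (hn : 1 ≤ n) (hs : 1 / 2 ≤ s)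
    (hanti : ∀ k, 1 ≤ k → k + 2 ≤ n → c (k + 1) ≤ c k) (hpos : 0 ≤ c (n - 1))
    (hfirst : 2 ≤ n → s ^ 2 * c 1 ≤ (2 * s - 1) * c 0) :
    (∑ k ∈ range n, c k * (v (n - k) ^ 2 - v (n - k - 1) ^ 2)) / 2 ≤
      (s * v n + (1 - s) * v (n - 1)) * ∑ k ∈ range n, c k * (v (n - k) - v (n - k - 1)) := by
  set w := s * v n + (1 - s) * v (n - 1) with hw
  have hsum : w * ∑ k ∈ range n, c k * (v (n - k) - v (n - k - 1)) -
      (∑ k ∈ range n, c k * (v (n - k) ^ 2 - v (n - k - 1) ^ 2)) / 2 =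
      (∑ k ∈ range n, c k * ((w - v (n - (k + 1))) ^ 2 - (w - v (n - k)) ^ 2)) / 2 := by
    rw [mul_sum, sum_div, sum_div, ← sum_sub_distrib]
    refine sum_congr rfl fun k _ => ?_
    rw [Nat.sub_sub]
    ring
  rw [← sub_nonneg, hsum]
  refine div_nonneg ?_ two_pos.le
  obtain ⟨m, rfl⟩ : ∃ m, n = m + 1 := ⟨n - 1, by omega⟩
  rw [sum_range_succ']
  simp only [Nat.add_sub_cancel, Nat.sub_zero, zero_add] at *
  have e1 : w - v m = s * (v (m + 1) - v m) := by rw [hw]; ring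
  have e2 : w - v (m + 1) = -(1 - s) * (v (m + 1) - v m) := by rw [hw]; ring
  rw [e1, e2]
  rcases Nat.eq_zero_or_pos m with rfl | hm
  · have : 0 ≤ c 0 * ((2 * s - 1) * (v 1 - v 0) ^ 2) :=
      mul_nonneg hpos (mul_nonneg (by linarith) (sq_nonneg _))
    simp
    linarith
  · obtain ⟨p, rfl⟩ : ∃ p, m = p + 1 := ⟨m - 1, by omega⟩
    -- Summing by parts from `k = 1` costs `c 1 * s²` times the squared last increment; the `k = 0`
    -- term supplies `(2s-1) * c 0` times it, so `hfirst` is exactly what is needed.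
    have h := sub_le_sum_mul_sub (c := fun k => c (k + 1))
      (y := fun k => (w - v (p + 1 + 1 - (k + 1))) ^ 2) p
      (fun k hk => hanti (k + 1) (by omega) (by omega)) (fun k _ _ => sq_nonneg _)
    simp only [zero_add, Nat.add_sub_cancel] at h
    rw [e1] at h
    have h1 := mul_nonneg hpos (sq_nonneg (w - v (p + 1 + 1 - (p + 1 + 1))))
    have h2 := mul_le_mul_of_nonneg_right (hfirst (by omega))
      (sq_nonneg (v (p + 1 + 1) - v (p + 1)))
    nlinarith

/-! ### The fractional centred difference weights -/

theorem gCoef_neg (β : ℝ) (k : ℤ) : gCoef β (-k) = gCoef β k := by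
  unfold gCoef
  have : (-1 : ℝ) ^ (-k) = (-1 : ℝ) ^ k := by
    rw [zpow_neg, ← inv_zpow, inv_neg_one]
  rw [this, Int.cast_neg, sub_neg_eq_add, ← sub_eq_add_neg, mul_comm (Real.Gamma (β / 2 + k + 1))]

theorem half_ne_intCast {β : ℝ} (hβ1 : 1 < β) (hβ2 : β < 2) (j : ℤ) : β / 2 ≠ j := by
  intro h
  have h0 : (0 : ℝ) < j := by linarith
  have h1 : (j : ℝ) < 1 := by linarith
  have : 0 < j := by exact_mod_cast h0
  have : j < 1 := by exact_mod_cast h1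
  omega

theorem gCoef_succ {β : ℝ} (hβ1 : 1 < β) (hβ2 : β < 2) (k : ℤ) :
    (k + 1 + β / 2) * gCoef β (k + 1) = (k - β / 2) * gCoef β k := by
  have h1 : β / 2 - k ≠ 0 := sub_ne_zero.mpr (half_ne_intCast hβ1 hβ2 k)
  have h2 : β / 2 + k + 1 ≠ 0 := fun h =>
    half_ne_intCast hβ1 hβ2 (-k - 1) (by push_cast; linarith)
  have hG1 : Real.Gamma (β / 2 - k) ≠ 0 := Real.Gamma_ne_zero fun m h =>
    half_ne_intCast hβ1 hβ2 (k - m) (by push_cast; linarith)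
  have hG2 : Real.Gamma (β / 2 + k + 1) ≠ 0 := Real.Gamma_ne_zero fun m h =>
    half_ne_intCast hβ1 hβ2 (-k - 1 - m) (by push_cast; linarith)
  unfold gCoef
  push_cast
  rw [show β / 2 - ((k : ℝ) + 1) + 1 = β / 2 - k by ring, Real.Gamma_add_one h1,
    show β / 2 + ((k : ℝ) + 1) + 1 = β / 2 + k + 1 + 1 by ring, Real.Gamma_add_one h2,
    zpow_add_one₀ (by norm_num), show (k : ℝ) + 1 + β / 2 = β / 2 + k + 1 by ring,
    show (k : ℝ) - β / 2 = -(β / 2 - k) by ring]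
  generalize Real.Gamma (β / 2 - k) = G₁ at *
  generalize Real.Gamma (β / 2 + k + 1) = G₂ at *
  generalize β / 2 - (k : ℝ) = p at *
  generalize β / 2 + (k : ℝ) + 1 = q at *
  field_simp

theorem gCoef_zero_pos {β : ℝ} (hβ1 : 1 < β) : 0 < gCoef β 0 := by
  have h1 := Real.Gamma_pos_of_pos (by linarith : 0 < β + 1)
  have h2 := Real.Gamma_pos_of_pos (by linarith : 0 < β / 2 + 1)
  simp only [gCoef, zpow_zero, Int.cast_zero, sub_zero, add_zero, one_mul]
  positivity

theorem gCoef_neg_of_pos {β : ℝ} (hβ1 : 1 < β) (hβ2 : β < 2) {k : ℕ} (hk : 1 ≤ k) :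
    gCoef β k < 0 := by
  induction k, hk using Nat.le_induction with
  | base =>
    have h := gCoef_succ hβ1 hβ2 0
    have h0 := gCoef_zero_pos hβ1
    simp only [Int.cast_zero, zero_add, zero_sub] at h
    rw [Nat.cast_one]
    by_contra! hc
    nlinarith
  | succ k hk ih =>
    have h := gCoef_succ hβ1 hβ2 k
    have hk' : (1 : ℝ) ≤ k := by exact_mod_cast hk
    push_cast at h ⊢
    by_contra! hc
    nlinarith

theorem gCoef_nonpos {β : ℝ} (hβ1 : 1 < β) (hβ2 : β < 2) {k : ℤ} (hk : k ≠ 0) :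
    gCoef β k ≤ 0 := by
  rcases Int.natAbs_eq k with h | h
  · rw [h]
    exact (gCoef_neg_of_pos hβ1 hβ2 (by omega)).le
  · rw [h, gCoef_neg]
    exact (gCoef_neg_of_pos hβ1 hβ2 (by omega)).le

/-- A discrete antiderivative of `β g_k^{(β)}`; for `k ≥ 1` it is `β` times the tail
`∑_{j ≥ k} |g_j^{(β)}|`. -/
noncomputable def gTail (β : ℝ) (k : ℤ) : ℝ := -((k : ℝ) + β / 2) * gCoef β k

theorem gTail_succ {β : ℝ} (hβ1 : 1 < β) (hβ2 : β < 2) (k : ℤ) :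
    gTail β (k + 1) = -(k - β / 2) * gCoef β k := by
  have := gCoef_succ hβ1 hβ2 k
  rw [gTail]
  push_cast
  linarith

theorem gTail_succ_sub {β : ℝ} (hβ1 : 1 < β) (hβ2 : β < 2) (k : ℤ) :
    gTail β (k + 1) - gTail β k = β * gCoef β k := by
  rw [gTail_succ hβ1 hβ2, gTail]
  ring

theorem gTail_neg {β : ℝ} (hβ1 : 1 < β) (hβ2 : β < 2) (k : ℤ) :
    gTail β (-k) = -gTail β (k + 1) := by
  rw [gTail_succ hβ1 hβ2, gTail, gCoef_neg]
  push_cast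
  ring

theorem sum_gCoef_sub {β : ℝ} (hβ1 : 1 < β) (hβ2 : β < 2) (i : ℤ) (n : ℕ) :
    β * ∑ j ∈ Icc (1 : ℤ) n, gCoef β (i - j) = gTail β i - gTail β (i - n) := by
  induction n with
  | zero => simp
  | succ n ih =>
    have e : Icc (1 : ℤ) ((n + 1 : ℕ) : ℤ) = insert ((n : ℤ) + 1) (Icc (1 : ℤ) n) := by
      ext j
      simp only [mem_Icc, mem_insert]
      push_cast
      omega
    rw [e, sum_insert (by simp), mul_add, ih, ← gTail_succ_sub hβ1 hβ2]
    push_cast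
    rw [show i - ((n : ℤ) + 1) + 1 = i - n by ring]
    ring

theorem sum_gCoef_row {β : ℝ} (hβ1 : 1 < β) (hβ2 : β < 2) (i : ℤ) {M : ℕ} (hM : 1 ≤ M) :
    β * ∑ j ∈ Icc (1 : ℤ) ((M : ℤ) - 1), gCoef β (i - j) = gTail β i + gTail β (M - i) := by
  have h := sum_gCoef_sub hβ1 hβ2 i (M - 1)
  rw [Nat.cast_sub hM, Nat.cast_one] at h
  rw [h, show i - ((M : ℤ) - 1) = -((M : ℤ) - i - 1) by ring, gTail_neg hβ1 hβ2,
    sub_add_cancel]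
  ring

theorem gTail_pos {β : ℝ} (hβ1 : 1 < β) (hβ2 : β < 2) {k : ℕ} (hk : 1 ≤ k) :
    0 < gTail β k := by
  have h := gCoef_neg_of_pos hβ1 hβ2 hk
  have : (0 : ℝ) < k + β / 2 := by positivity
  rw [gTail, Int.cast_natCast]
  nlinarith

theorem gTail_succ_le {β : ℝ} (hβ1 : 1 < β) (hβ2 : β < 2) {k : ℕ} (hk : 1 ≤ k) :
    gTail β (k + 1) ≤ gTail β k := by
  have h1 := gTail_succ_sub hβ1 hβ2 k
  have h2 := gCoef_neg_of_pos hβ1 hβ2 hk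
  nlinarith

/-- The ratio of consecutive tails is `(k+β/2)/(k-β/2) ≤ 1 + β/(k-1) ≤ (k/(k-1))^β` by Bernoulli, so
`(k-1)^β` times the tail is nondecreasing from `k = 3`. -/
theorem gTail_three_mul_le {β : ℝ} (hβ1 : 1 < β) (hβ2 : β < 2) {k : ℕ} (hk : 3 ≤ k) :
    gTail β 3 * (2 / ((k : ℝ) - 1)) ^ β ≤ gTail β k := by
  induction k, hk using Nat.le_induction with
  | base => norm_num
  | succ k hk ih =>
    have hk' : (3 : ℝ) ≤ k := by exact_mod_cast hk
    have hk0 : 0 < (k : ℝ) := by linarith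
    have hk1 : 0 < (k : ℝ) - 1 := by linarith
    have hb : 0 < (k : ℝ) - β / 2 := by linarith
    have hB : ((k : ℝ) + β / 2) / (k - β / 2) ≤ (k / (k - 1)) ^ β := by
      have h := one_add_mul_self_le_rpow_one_add (s := 1 / ((k : ℝ) - 1))
        (by have : 0 ≤ 1 / ((k : ℝ) - 1) := by positivity
            linarith) hβ1.le
      rw [show 1 + 1 / ((k : ℝ) - 1) = k / (k - 1) by field_simp; ring] at h
      refine le_trans ?_ h
      have : β / (k - β / 2) ≤ β / (k - 1) := by gcongr; linarith
      calc ((k : ℝ) + β / 2) / (k - β / 2) = 1 + β / (k - β / 2) := by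
            rw [one_add_div hb.ne']; congr 1; ring
        _ ≤ 1 + β * (1 / (k - 1)) := by rw [mul_one_div]; linarith
    have hQ : gTail β k = gTail β (k + 1) * (((k : ℝ) + β / 2) / (k - β / 2)) := by
      rw [gTail_succ hβ1 hβ2, gTail]
      push_cast
      rw [mul_div_assoc', eq_div_iff hb.ne']
      ring
    have hpos : 0 < gTail β ((k : ℤ) + 1) := by exact_mod_cast gTail_pos hβ1 hβ2 (by omega : 1 ≤ k + 1)
    have e : (2 / ((k : ℝ) - 1)) ^ β = (2 / (k : ℝ)) ^ β * (k / (k - 1)) ^ β := by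
      rw [← Real.mul_rpow (by positivity) (by positivity)]
      congr 1
      field_simp
    have h1 := mul_le_mul_of_nonneg_left hB hpos.le
    rw [← hQ] at h1
    have h2 := ih.trans h1
    rw [e, ← mul_assoc] at h2
    push_cast
    rw [add_sub_cancel_right]
    exact le_of_mul_le_mul_right h2 (Real.rpow_pos_of_pos (by positivity) β)

theorem gTail_three_mul_rpow_le {β : ℝ} (hβ1 : 1 < β) (hβ2 : β < 2) {k M : ℕ} (hk : 1 ≤ k)
    (hkM : k + 1 ≤ M) : gTail β 3 * (2 / (M : ℝ)) ^ β ≤ gTail β k := by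
  have h3 : 0 < gTail β 3 := gTail_pos hβ1 hβ2 (k := 3) (by norm_num)
  have hM : (k : ℝ) + 1 ≤ M := by exact_mod_cast hkM
  have hk' : (1 : ℝ) ≤ k := by exact_mod_cast hk
  rcases le_total 3 k with h | h
  · have hk3 : (3 : ℝ) ≤ k := by exact_mod_cast h
    refine le_trans (mul_le_mul_of_nonneg_left ?_ h3.le) (gTail_three_mul_le hβ1 hβ2 h)
    refine Real.rpow_le_rpow (by positivity) ?_ (by linarith)
    exact div_le_div_of_nonneg_left two_pos.le (by linarith) (by linarith)
  · have h1 : (2 / (M : ℝ)) ^ β ≤ 1 :=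
      Real.rpow_le_one (by positivity) ((div_le_one (by linarith)).mpr (by linarith)) (by linarith)
    have h4 : gTail β 3 ≤ gTail β k := by
      have a1 := gTail_succ_le hβ1 hβ2 (k := 1) le_rfl
      have a2 := gTail_succ_le hβ1 hβ2 (k := 2) one_le_two
      norm_num at a1 a2
      interval_cases k
      · exact_mod_cast a2.trans a1
      · exact_mod_cast a2
      · exact le_rfl
    nlinarith

theorem rConst_eq {β : ℝ} (hβ1 : 1 < β) (hβ2 : β < 2) :
    rConst β = Real.exp (-2) * gTail β 3 * (3 + β / 2) ^ β := by
  have h0 : gCoef β 0 = Real.Gamma (β + 1) / Real.Gamma (β / 2 + 1) ^ 2 := by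
    simp only [gCoef, zpow_zero, Int.cast_zero, sub_zero, add_zero, one_mul, sq]
  have h1 := gCoef_succ hβ1 hβ2 0
  have h2 := gCoef_succ hβ1 hβ2 1
  have h3 := gTail_succ hβ1 hβ2 2
  norm_num at h1 h2 h3
  have e1 : gCoef β 1 = -(β / 2) * gCoef β 0 / (1 + β / 2) := by
    rw [eq_div_iff (by linarith)]
    linarith
  have e2 : gCoef β 2 = (1 - β / 2) * gCoef β 1 / (1 + 1 + β / 2) := by
    rw [eq_div_iff (by linarith)]
    linarith
  rw [h3, e2, e1, rConst, h0, Real.rpow_add_one (by linarith)]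
  have : 6 + β ≠ 0 := by linarith
  have : 4 + β ≠ 0 := by linarith
  have : 2 + β ≠ 0 := by linarith
  have : 1 + β / 2 ≠ 0 := by linarith
  have : 1 + 1 + β / 2 ≠ 0 := by linarith
  field_simp
  ring

theorem cStar_pos {β : ℝ} (hβ1 : 1 < β) (hβ2 : β < 2) : 0 < cStar β := by
  have h3 : 0 < gTail β 3 := gTail_pos hβ1 hβ2 (k := 3) (by norm_num)
  rw [cStar, rConst_eq hβ1 hβ2]
  positivity

/-- By `rConst_eq` this follows from `3 + β/2 ≤ 4`; the factor `e^{-2}` is simply bounded by `1`. -/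
theorem rConst_mul_le_gTail {β : ℝ} (hβ1 : 1 < β) (hβ2 : β < 2) {k M : ℕ} (hk : 1 ≤ k)
    (hkM : k + 1 ≤ M) : rConst β * (2 * (M : ℝ)) ^ (-β) ≤ gTail β k := by
  have h3 : 0 < gTail β 3 := gTail_pos hβ1 hβ2 (k := 3) (by norm_num)
  have hM : (0 : ℝ) < M := by exact_mod_cast (by omega : 0 < M)
  refine le_trans ?_ (gTail_three_mul_rpow_le hβ1 hβ2 hk hkM)
  rw [rConst_eq hβ1 hβ2, Real.rpow_neg (by positivity)]
  have h4 : (3 + β / 2) ^ β * ((2 * (M : ℝ)) ^ β)⁻¹ ≤ (2 / (M : ℝ)) ^ β := by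
    rw [← div_eq_mul_inv, ← Real.div_rpow (by positivity) (by positivity)]
    refine Real.rpow_le_rpow (by positivity) ?_ (by linarith)
    rw [div_le_div_iff₀ (by positivity) hM]
    nlinarith
  have h5 : Real.exp (-2) ≤ 1 := Real.exp_le_one_iff.mpr (by norm_num)
  calc _ = Real.exp (-2) * (gTail β 3 * ((3 + β / 2) ^ β * ((2 * (M : ℝ)) ^ β)⁻¹)) := by ring
    _ ≤ 1 * (gTail β 3 * (2 / (M : ℝ)) ^ β) := by gcongr
    _ = _ := one_mul _

/-! ### Coercivity of the spatial operator -/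

/-- Off the diagonal `g ≤ 0`, so `g v_i v_j ≥ g (v_i² + v_j²)/2`; by symmetry the form dominates the
row sums weighted by `v_i²`. Each row sum is a sum of two tails divided by `β`, whence the factor
`2/β` in `cStar`. -/
theorem coercivity {β : ℝ} (hβ1 : 1 < β) (hβ2 : β < 2) (M : ℕ) (v : ℤ → ℝ) :
    cStar β * (2 * (M : ℝ)) ^ (-β) * ∑ i ∈ Icc (1 : ℤ) ((M : ℤ) - 1), v i ^ 2 ≤
      ∑ i ∈ Icc (1 : ℤ) ((M : ℤ) - 1), v i * ∑ j ∈ Icc (1 : ℤ) ((M : ℤ) - 1),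
        gCoef β (i - j) * v j := by
  set I := Icc (1 : ℤ) ((M : ℤ) - 1)
  have hrow : ∀ i ∈ I, cStar β * (2 * (M : ℝ)) ^ (-β) ≤ ∑ j ∈ I, gCoef β (i - j) := by
    intro i hi
    obtain ⟨hi1, hi2⟩ := mem_Icc.mp hi
    obtain ⟨k, rfl⟩ : ∃ k : ℕ, i = k := ⟨i.toNat, by omega⟩
    have hr := sum_gCoef_row hβ1 hβ2 (k : ℤ) (M := M) (by omega)
    have h1 := rConst_mul_le_gTail hβ1 hβ2 (k := k) (M := M) (by omega) (by omega)
    have h2 := rConst_mul_le_gTail hβ1 hβ2 (k := M - k) (M := M) (by omega) (by omega)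
    rw [Nat.cast_sub (by omega)] at h2
    have hb : 0 < β := by linarith
    have e : β * (cStar β * (2 * (M : ℝ)) ^ (-β)) = 2 * (rConst β * (2 * (M : ℝ)) ^ (-β)) := by
      rw [cStar]
      field_simp
    refine le_of_mul_le_mul_left ?_ hb
    rw [hr, e]
    linarith
  have hsym : ∑ i ∈ I, ∑ j ∈ I, gCoef β (i - j) * v j ^ 2 =
      ∑ i ∈ I, ∑ j ∈ I, gCoef β (i - j) * v i ^ 2 := by
    rw [sum_comm]
    refine sum_congr rfl fun i _ => sum_congr rfl fun j _ => ?_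
    rw [← gCoef_neg, neg_sub]
  calc _ ≤ ∑ i ∈ I, ∑ j ∈ I, gCoef β (i - j) * v i ^ 2 := by
        rw [mul_sum]
        refine sum_le_sum fun i hi => ?_
        rw [← sum_mul]
        exact mul_le_mul_of_nonneg_right (hrow i hi) (sq_nonneg _)
    _ = ∑ i ∈ I, ∑ j ∈ I, gCoef β (i - j) * ((v i ^ 2 + v j ^ 2) / 2) := by
        have : ∀ i j, gCoef β (i - j) * ((v i ^ 2 + v j ^ 2) / 2) =
            gCoef β (i - j) * v i ^ 2 / 2 + gCoef β (i - j) * v j ^ 2 / 2 := by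
          intro i j
          ring
        simp only [this, sum_add_distrib, ← sum_div]
        rw [hsym]
        ring
    _ ≤ _ := by
        simp only [mul_sum]
        refine sum_le_sum fun i _ => sum_le_sum fun j _ => ?_
        by_cases h : i = j
        · subst h
          linarith
        · have hg := gCoef_nonpos hβ1 hβ2 (sub_ne_zero.mpr h)
          nlinarith [mul_nonneg (neg_nonneg.mpr hg) (sq_nonneg (v i - v j))]

theorem sum_gCoef_mul_eq {β : ℝ} {M : ℕ} {w : ℤ → ℝ} (h0 : w 0 = 0) (hM : w M = 0)
    (i : ℤ) : ∑ k ∈ Icc (i - (M : ℤ)) i, gCoef β k * w (i - k) =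
      ∑ j ∈ Icc (1 : ℤ) ((M : ℤ) - 1), gCoef β (i - j) * w j := by
  have h : ∑ k ∈ Icc (i - (M : ℤ)) i, gCoef β k * w (i - k) =
      ∑ j ∈ Icc (0 : ℤ) M, gCoef β (i - j) * w j := by
    refine sum_bij' (fun k _ => i - k) (fun j _ => i - j) ?_ ?_ ?_ ?_ ?_
    · intro k hk
      simp only [mem_Icc] at hk ⊢
      omega
    · intro k hk
      simp only [mem_Icc] at hk ⊢
      omega
    · intro k _
      simp
    · intro k _
      simp
    · intro k _
      simp
  rw [h]
  symm
  refine sum_subset (Icc_subset_Icc (by norm_num) (by omega)) fun j hj hj' => ?_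
  simp only [mem_Icc] at hj hj'
  rcases (by omega : j = 0 ∨ j = M) with rfl | rfl
  · rw [h0, mul_zero]
  · rw [hM, mul_zero]


/-! ### The energy estimate and the induction in time -/

theorem gridNorm_sq {h : ℝ} (hh : 0 ≤ h) (M : ℕ) (v : ℤ → ℝ) :
    gridNorm h M v ^ 2 = h * ∑ i ∈ Icc (1 : ℤ) ((M : ℤ) - 1), v i ^ 2 := by
  have e : gridInner h M v v = h * ∑ i ∈ Icc (1 : ℤ) ((M : ℤ) - 1), v i ^ 2 := by
    simp only [gridInner, sq]
  rw [gridNorm, e, Real.sq_sqrt (mul_nonneg hh (sum_nonneg fun _ _ => sq_nonneg _))]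

theorem energy_step {ω φ : ℝ → ℝ} {f : ℝ → ℝ → ℝ} {L T K β : ℝ} {J M N : ℕ} {σ : ℝ}
    {u : ℕ → ℤ → ℝ} (hu : IsSchemeSolution ω φ f L T K β J M N σ u) (hL : 0 < L) (hT : 0 < T)
    (hK : 0 < K) (hβ1 : 1 < β) (hβ2 : β < 2) (hM : 1 ≤ M)
    (hω : ∀ α ∈ Set.Icc (0 : ℝ) 1, 0 ≤ ω α) (hσ0 : 1 / 2 ≤ σ) (hσ1 : σ ≤ 1)
    (hσroot : shiftFun ω J (T / N) σ = 0) {n : ℕ} (hn : 1 ≤ n) (hnN : n ≤ N)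
    (hpos : 0 ≤ coefHat ω J (T / N) σ n (n - 1)) :
    ∑ k ∈ range n, coefHat ω J (T / N) σ n k *
        (gridNorm (L / M) M (u (n - k)) ^ 2 - gridNorm (L / M) M (u (n - k - 1)) ^ 2) ≤
      gridNorm (L / M) M (sourceGrid f (L / M) (T / N) σ n) ^ 2 /
        (2 * (K * cStar β * (2 * L) ^ (-β))) := by
  have hN : (0 : ℝ) < N := by exact_mod_cast (by omega : 0 < N)
  have hM0 : (0 : ℝ) < M := by exact_mod_cast hM
  have hτ : 0 < T / N := by positivity
  have hh : 0 < L / M := by positivity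
  have hc := cStar_pos hβ1 hβ2
  set c := coefHat ω J (T / N) σ n
  set I := Icc (1 : ℤ) ((M : ℤ) - 1)
  set F := sourceGrid f (L / M) (T / N) σ n
  set w : ℤ → ℝ := fun i => σ * u n i + (1 - σ) * u (n - 1) i with hw
  set A := K * cStar β * (2 * L) ^ (-β) with hA
  have hA0 : 0 < A := by positivity
  have hw0 : w 0 = 0 := by
    simp [hw, hu.boundary_left n hnN, hu.boundary_left (n - 1) (by omega)]
  have hwM : w M = 0 := by
    simp [hw, hu.boundary_right n hnN, hu.boundary_right (n - 1) (by omega)]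
  have hstep : ∀ i ∈ I, ∑ k ∈ range n, c k * (u (n - k) i - u (n - k - 1) i) =
      -K * (L / M) ^ (-β) * ∑ j ∈ I, gCoef β (i - j) * w j + F i := by
    intro i hi
    obtain ⟨h1, h2⟩ := mem_Icc.mp hi
    rw [hu.step n hn hnN i h1 h2, ← sum_gCoef_mul_eq hw0 hwM]
  have hlow : (∑ k ∈ range n, c k * (∑ i ∈ I, u (n - k) i ^ 2 - ∑ i ∈ I, u (n - k - 1) i ^ 2)) / 2
      ≤ ∑ i ∈ I, w i * ∑ k ∈ range n, c k * (u (n - k) i - u (n - k - 1) i) := by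
    have e : ∑ k ∈ range n, c k * (∑ i ∈ I, u (n - k) i ^ 2 - ∑ i ∈ I, u (n - k - 1) i ^ 2) =
        ∑ i ∈ I, ∑ k ∈ range n, c k * (u (n - k) i ^ 2 - u (n - k - 1) i ^ 2) := by
      rw [sum_comm]
      refine sum_congr rfl fun k _ => ?_
      rw [← sum_sub_distrib, mul_sum]
    rw [e, sum_div]
    exact sum_le_sum fun i _ => half_sum_sq_le_shift_mul_sum (v := fun m => u m i) hn hσ0
      (fun k hk hkn => coefHat_succ_le hω J hτ (by linarith) hk hkn) hpos
      (fun h2 => sq_mul_coefHat_one_le hω J hτ hσ0 hσ1 hσroot h2)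
  have hco := coercivity hβ1 hβ2 M w
  have hscale : (L / M) ^ (-β) * (2 * (M : ℝ)) ^ (-β) = (2 * L) ^ (-β) := by
    rw [← Real.mul_rpow hh.le (by positivity)]
    congr 1
    field_simp
  have hup : ∑ i ∈ I, w i * ∑ k ∈ range n, c k * (u (n - k) i - u (n - k - 1) i) ≤
      -A * ∑ i ∈ I, w i ^ 2 + ∑ i ∈ I, w i * F i := by
    have e : ∑ i ∈ I, w i * ∑ k ∈ range n, c k * (u (n - k) i - u (n - k - 1) i) =
        -(K * (L / M) ^ (-β) * ∑ i ∈ I, w i * ∑ j ∈ I, gCoef β (i - j) * w j) +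
          ∑ i ∈ I, w i * F i := by
      rw [mul_sum, ← sum_neg_distrib, ← sum_add_distrib]
      refine sum_congr rfl fun i hi => ?_
      rw [hstep i hi]
      ring
    have hKh : 0 ≤ K * (L / M) ^ (-β) := by positivity
    have h := mul_le_mul_of_nonneg_left hco hKh
    have e2 : K * (L / M) ^ (-β) * (cStar β * (2 * (M : ℝ)) ^ (-β) * ∑ i ∈ I, w i ^ 2) =
        A * ∑ i ∈ I, w i ^ 2 := by
      rw [hA, ← hscale]
      ring
    rw [e]
    linarith
  -- Young's inequality is weighted so that the coercive term is used up entirely.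
  have hyoung : -A * ∑ i ∈ I, w i ^ 2 + ∑ i ∈ I, w i * F i ≤ (∑ i ∈ I, F i ^ 2) / (4 * A) := by
    rw [mul_sum, ← sum_add_distrib, sum_div]
    refine sum_le_sum fun i _ => ?_
    rw [le_div_iff₀ (by positivity)]
    nlinarith [sq_nonneg (2 * A * w i - F i)]
  have hfin : ∑ k ∈ range n, c k * (∑ i ∈ I, u (n - k) i ^ 2 - ∑ i ∈ I, u (n - k - 1) i ^ 2) ≤
      (∑ i ∈ I, F i ^ 2) / (2 * A) := by
    have e : (∑ i ∈ I, F i ^ 2) / (2 * A) = 2 * ((∑ i ∈ I, F i ^ 2) / (4 * A)) := by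
      field_simp
      norm_num
    rw [e]
    linarith
  simp only [gridNorm_sq hh.le]
  calc _ = L / M * ∑ k ∈ range n, c k *
        (∑ i ∈ I, u (n - k) i ^ 2 - ∑ i ∈ I, u (n - k - 1) i ^ 2) := by
        rw [mul_sum]
        exact sum_congr rfl fun k _ => by ring
    _ ≤ L / M * ((∑ i ∈ I, F i ^ 2) / (2 * A)) := mul_le_mul_of_nonneg_left hfin hh.le
    _ = _ := by ring

/-- One step of the discrete Grönwall argument: if the values before time `n` are bounded by `B`,
so is the value at time `n`. -/
theorem le_of_sum_mul_sub_le {c E : ℕ → ℝ} {n : ℕ} {B R : ℝ} (hn : 1 ≤ n)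
    (hanti : ∀ k, k + 2 ≤ n → c (k + 1) ≤ c k) (hpos : 0 < c (n - 1))
    (hE : ∀ m < n, E m ≤ B) (hsum : ∑ k ∈ range n, c k * (E (n - k) - E (n - k - 1)) ≤ R)
    (hR : R ≤ c (n - 1) * (B - E 0)) : E n ≤ B := by
  obtain ⟨m, rfl⟩ : ∃ m, n = m + 1 := ⟨n - 1, by omega⟩
  rw [Nat.add_sub_cancel] at hpos hR
  -- The gaps `B - E` at earlier times are nonnegative; the unknown gap enters only at `k = 0`,
  -- where summation by parts requires no sign.
  have h := sub_le_sum_mul_sub (c := c) (y := fun k => B - E (m + 1 - k)) m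
    (fun k hk => hanti k (by omega)) (fun k hk _ => sub_nonneg.mpr (hE _ (by omega)))
  have e : ∑ k ∈ range (m + 1), c k * ((B - E (m + 1 - (k + 1))) - (B - E (m + 1 - k))) =
      ∑ k ∈ range (m + 1), c k * (E (m + 1 - k) - E (m + 1 - k - 1)) :=
    sum_congr rfl fun k _ => by rw [Nat.sub_sub]; ring
  rw [e] at h
  simp only [Nat.sub_self, Nat.sub_zero] at h
  have hc0 : ∀ j ≤ m, c j ≤ c 0 := by
    intro j
    induction j with
    | zero => exact fun _ => le_rfl
    | succ j ih => exact fun hj => (hanti j (by omega)).trans (ih (by omega))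
  have hc := hpos.trans_le (hc0 m le_rfl)
  have : 0 ≤ c 0 * (B - E (m + 1)) := by linarith
  exact sub_nonneg.mp (nonneg_of_mul_nonneg_right this hc)

end DistRiesz

theorem mainTheorem2 (L T K β : ℝ) (hL : 0 < L) (hT : 0 < T) (hK : 0 < K)
    (hβ1 : 1 < β) (hβ2 : β < 2)
    (J M N : ℕ) (hJ : 1 ≤ J) (hM : 1 ≤ M) (hN : 1 ≤ N)
    (ω : ℝ → ℝ) (hω : ∀ α ∈ Set.Icc (0 : ℝ) 1, 0 ≤ ω α)
    (hωpos : ∃ r : ℕ, r < 2 * J ∧ 0 < ω (DistRiesz.node J r))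
    (φ : ℝ → ℝ) (f : ℝ → ℝ → ℝ)
    (σ : ℝ) (hσ : σ ∈ Set.Icc (1 / 2 : ℝ) 1)
    (hσroot : DistRiesz.shiftFun ω J (T / N) σ = 0)
    (u : ℕ → ℤ → ℝ)
    (hu : DistRiesz.IsSchemeSolution ω φ f L T K β J M N σ u)
    (n : ℕ) (hn : 1 ≤ n) (hnN : n ≤ N) :
    DistRiesz.gridNorm (L / M) M (u n) ^ 2 ≤
      DistRiesz.gridNorm (L / M) M (u 0) ^ 2 +
        (2 * L) ^ β /
            (K * DistRiesz.cStar β *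
              ∑ r ∈ Finset.range (2 * J + 1),
                DistRiesz.lam ω J r /
                  (T ^ DistRiesz.node J r * Real.Gamma (1 - DistRiesz.node J r))) *
          (Finset.Icc 1 n).sup' (Finset.nonempty_Icc.mpr hn)
            (fun l => DistRiesz.gridNorm (L / M) M
              (DistRiesz.sourceGrid f (L / M) (T / N) σ l) ^ 2) := by
  have hN0 : (0 : ℝ) < N := by exact_mod_cast hN
  have hτ : 0 < T / N := by positivity
  have hc := DistRiesz.cStar_pos hβ1 hβ2
  have hS := DistRiesz.sum_lam_div_pos hω hJ hT hωpos
  set S := ∑ r ∈ Finset.range (2 * J + 1), DistRiesz.lam ω J r /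
    (T ^ DistRiesz.node J r * Real.Gamma (1 - DistRiesz.node J r)) with hSdef
  set E : ℕ → ℝ := fun m => DistRiesz.gridNorm (L / M) M (u m) ^ 2
  set g : ℕ → ℝ := fun l => DistRiesz.gridNorm (L / M) M
    (DistRiesz.sourceGrid f (L / M) (T / N) σ l) ^ 2
  set G := (Finset.Icc 1 n).sup' (Finset.nonempty_Icc.mpr hn) g
  have hgG : ∀ l, 1 ≤ l → l ≤ n → g l ≤ G := fun l h1 h2 =>
    Finset.le_sup' g (Finset.mem_Icc.mpr ⟨h1, h2⟩)
  have hG : 0 ≤ G := (sq_nonneg _).trans (hgG n hn le_rfl)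
  set C := (2 * L) ^ β / (K * DistRiesz.cStar β * S) with hC
  have hCpos : 0 < C := by positivity
  have main : ∀ m ≤ n, E m ≤ E 0 + C * G := by
    intro m
    induction m using Nat.strong_induction_on with
    | _ m ih =>
      intro hmn
      rcases Nat.eq_zero_or_pos m with rfl | hm
      · exact le_add_of_nonneg_right (mul_nonneg hCpos.le hG)
      have hlast := DistRiesz.half_sum_le_coefHat_last hω J hT hσ.1 hσ.2 hm (hmn.trans hnN)
      rw [← hSdef] at hlast
      have hpos : 0 < DistRiesz.coefHat ω J (T / N) σ m (m - 1) := by linarith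
      refine DistRiesz.le_of_sum_mul_sub_le hm
        (fun k hk => DistRiesz.coefHat_antitone hω J hτ hσ.1 hσ.2 hσroot hpos hk) hpos
        (fun l hl => ih l hl (by omega))
        (DistRiesz.energy_step hu hL hT hK hβ1 hβ2 hM hω hσ.1 hσ.2 hσroot hm (hmn.trans hnN)
          hpos.le) ?_
      rw [add_sub_cancel_left]
      -- The constant `C` is chosen so that the source bound is at most `S/2 * (C * G)`, which
      -- `hlast` then compares with the last coefficient.
      calc g m / (2 * (K * DistRiesz.cStar β * (2 * L) ^ (-β)))
          ≤ G / (2 * (K * DistRiesz.cStar β * (2 * L) ^ (-β))) := by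
            gcongr
            exact hgG m hm hmn
        _ = S / 2 * (C * G) := by
            rw [hC, Real.rpow_neg (by positivity)]
            field_simp
        _ ≤ _ := by gcongr
  exact main n le_rfl
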